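/- Let $M=\{1,\dots,m\}$ be a set of $m\ge 1$ items. An additive valuation is a function $v:2^M\to\mathbb{R}_{\ge 0}$ with $v(S)=\sum_{a\in S}v(\{a\})$ for all $S\subseteq M$ (such a $v$ satisfies $v(\emptyset)=0$ and is monotone). For $0\le k\le m$, a set $S\subseteq M$ is $k$-optimal if $|S|=k$ and $v(T)\le v(S)$ for every $T\subseteq M$ with $|T|=k$. A value query is a set $S\subseteq M$ and is answered by $v(S)$. A demand query is a price vector $p\in\mathbb{R}_{\ge 0}^m$ and is answered by some set $D\subseteq M$ that maximizes $v(D)-\sum_{i\in D}p_i$. If several sets are maximizers, the oracle may return any of them; its choice may be adversarial and may depend on $v$, on the algorithm, and on everything that has happened in the run so far, that is, on all earlier queries, answers and random choices of the algorithm. A randomized algorithm asks value and demand queries adaptively and may draw uniformly random elements of finite sets; only its queries are counted. **Theorem.** There are a constant $C$ and, for all integers $m\ge 1$ and $0\le k\le m$, a randomized algorithm $A_{m,k}$, such that for every additive valuation $v$ on $m$ items and every demand oracle for $v$ (that is, for every tie-breaking as above): 1. every run of $A_{m,k}$ terminates and outputs a $k$-optimal set; 2. the expected number of value and demand queries made by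 $A_{m,k}$, over its internal randomness, is at most $C\log^3 m$. -/

import Mathlib

open scoped NNReal ENNReal

namespace KOpt

/-- A valuation over the item set `Fin m`: non-negative, normalized and monotone. -/
structure IsValuation {m : ℕ} (v : Finset (Fin m) → ℝ) : Prop where
  nonneg : ∀ S, 0 ≤ v S
  normalized : v ∅ = 0
  monotone : ∀ S T, S ⊆ T → v S ≤ v T

/-- An additive valuation: the value of a bundle is the sum of the values of its items. -/
structure IsAdditiveValuation {m : ℕ} (v : Finset (Fin m) → ℝ) : Prop extends IsValuation v where
  additive : ∀ S, v S = ∑ a ∈ S, v {a}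

/-- `S` is `k`-optimal: it has size `k` and is most valuable among the sets of size `k`. -/
def IsKOptimal {m : ℕ} (v : Finset (Fin m) → ℝ) (k : ℕ) (S : Finset (Fin m)) : Prop :=
  S.card = k ∧ ∀ T : Finset (Fin m), T.card = k → v T ≤ v S

/-- `D` is a demanded set at the item prices `p`: it maximizes the profit `v(D) - p(D)`. -/
def IsDemanded {m : ℕ} (v : Finset (Fin m) → ℝ) (p : Fin m → ℝ≥0) (D : Finset (Fin m)) : Prop :=
  ∀ T : Finset (Fin m), v T - ∑ i ∈ T, (p i : ℝ) ≤ v D - ∑ i ∈ D, (p i : ℝ)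

/-- A randomized adaptive query algorithm on `m` items, as a decision tree all of whose branches
are finite. It stops with an output, or asks a value query or a demand query and continues
according to the answer, or draws a uniformly random element of a set with `n + 1` elements. -/
inductive QueryAlg (m : ℕ) : Type where
  | output (S : Finset (Fin m)) : QueryAlg m
  | valueQuery (S : Finset (Fin m)) (next : ℝ → QueryAlg m) : QueryAlg m
  | demandQuery (p : Fin m → ℝ≥0) (next : Finset (Fin m) → QueryAlg m) : QueryAlg m
  | random (n : ℕ) (next : Fin (n + 1) → QueryAlg m) : QueryAlg m

/-- One step in the history of a run: a query with its answer, or a random draw with its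
outcome. -/
inductive Event (m : ℕ) : Type where
  | value (S : Finset (Fin m)) (x : ℝ) : Event m
  | demand (p : Fin m → ℝ≥0) (D : Finset (Fin m)) : Event m
  | random (n : ℕ) (i : Fin (n + 1)) : Event m

/-- A demand oracle for `v`. It answers every demand query by a demanded set, and ties are broken
arbitrarily: the choice may depend on everything that happened in the run so far (all queries,
answers and random outcomes, latest first). -/
structure DemandOracle {m : ℕ} (v : Finset (Fin m) → ℝ) where
  answer : List (Event m) → (Fin m → ℝ≥0) → Finset (Fin m)
  demanded : ∀ h p, IsDemanded v p (answer h p)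

/-- The joint law of the output and of the number of queries (value and demand) made when the
algorithm is run on `v` with the demand oracle `O`, after the history `h`. -/
noncomputable def QueryAlg.run {m : ℕ} (v : Finset (Fin m) → ℝ) (O : DemandOracle v) :
    QueryAlg m → List (Event m) → PMF (Finset (Fin m) × ℕ)
  | .output S, _ => PMF.pure (S, 0)
  | .valueQuery S next, h =>
      (QueryAlg.run v O (next (v S)) (.value S (v S) :: h)).map fun r => (r.1, r.2 + 1)
  | .demandQuery p next, h =>
      (QueryAlg.run v O (next (O.answer h p)) (.demand p (O.answer h p) :: h)).map
        fun r => (r.1, r.2 + 1)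
  | .random n next, h =>
      (PMF.uniformOfFintype (Fin (n + 1))).bind fun i =>
        QueryAlg.run v O (next i) (.random n i :: h)

/-- Every run of `A` on `v` with the demand oracle `O` outputs a `k`-optimal set. -/
def QueryAlg.AlwaysFinds {m : ℕ} (A : QueryAlg m) (v : Finset (Fin m) → ℝ) (O : DemandOracle v)
    (k : ℕ) : Prop :=
  ∀ r ∈ (A.run v O []).support, IsKOptimal v k r.1

/-- The expected number of queries of `A` on `v` with the demand oracle `O`. -/
noncomputable def QueryAlg.expectedQueries {m : ℕ} (A : QueryAlg m) (v : Finset (Fin m) → ℝ)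
    (O : DemandOracle v) : ℝ≥0∞ :=
  ∑' r, A.run v O [] r * (r.2 : ℝ≥0∞)

end KOpt

/-! For an additive valuation, a demand query at a uniform price acts as a threshold: items worth
more are bought, items worth less are not, and ties fall arbitrarily. This allows a quickselect on
sets A ⊆ B enclosing an optimum, with the values on B \ A confined to [a, b]. Progress is measured
by the number n of items strictly inside (a, b), because adversarial ties may linger at the
endpoints.

A random pivot has to avoid those ties. A query at the price (a + b)/2 first confines the survivors
to one half, where a single old endpoint c is left to avoid. As c is extremal there, v(S) = c|S|
tests whether S consists of ties only (`IsAdditiveValuation.eq_mul_card_iff`). Binary search over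
the prefixes of a random permutation then finds a uniformly random untied item
(`card_mul_sum_perm_first`) with about log m queries.

A uniform pivot lowers log(n + 1) by at least 1/6 on average (`sum_log_largerSide_le`). Hence O(log
m) rounds are expected and O(log² m) queries, more than is needed. The oracle cannot bias the pivot:
the candidates are fixed before the permutation is drawn, and the bounds hold for every history and
every demanded set. -/

namespace KOpt

open Finset

/-! ### Expected cost and correctness as one recursive quantity -/

section Cost

variable {m : ℕ}

/-- The expected number of queries plus the expected penalty `pen` of the output. -/
noncomputable def QueryAlg.penalizedCost (v : Finset (Fin m) → ℝ) (O : DemandOracle v)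
    (pen : Finset (Fin m) → ℝ≥0∞) : QueryAlg m → List (Event m) → ℝ≥0∞
  | .output S, _ => pen S
  | .valueQuery S next, h =>
      QueryAlg.penalizedCost v O pen (next (v S)) (.value S (v S) :: h) + 1
  | .demandQuery p next, h =>
      QueryAlg.penalizedCost v O pen (next (O.answer h p)) (.demand p (O.answer h p) :: h) + 1
  | .random n next, h =>
      ((n + 1 : ℕ) : ℝ≥0∞)⁻¹ *
        ∑ i, QueryAlg.penalizedCost v O pen (next i) (.random n i :: h)

theorem tsum_pmf_map_mul {α β : Type*} (p : PMF α) (g : α → β) (F : β → ℝ≥0∞) :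
    ∑' r, p.map g r * F r = ∑' a, p a * F (g a) := by
  classical
  simp only [PMF.map_apply, ← ENNReal.tsum_mul_right]
  rw [ENNReal.tsum_comm]
  refine tsum_congr fun a => ?_
  rw [tsum_eq_single (g a)]
  · simp
  · intro b hb
    simp [hb]

theorem tsum_pmf_bind_mul {α β : Type*} (p : PMF α) (q : α → PMF β) (F : β → ℝ≥0∞) :
    ∑' r, p.bind q r * F r = ∑' a, p a * ∑' r, q a r * F r := by
  simp only [PMF.bind_apply, ← ENNReal.tsum_mul_right, ← ENNReal.tsum_mul_left]
  rw [ENNReal.tsum_comm]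
  simp only [mul_assoc]

theorem tsum_pmf_map_succ_mul {α : Type*} (p : PMF (α × ℕ)) (pen : α → ℝ≥0∞) :
    ∑' r, p.map (fun r => (r.1, r.2 + 1)) r * (((r.2 : ℕ) : ℝ≥0∞) + pen r.1) =
      ∑' r, p r * ((r.2 : ℝ≥0∞) + pen r.1) + 1 := by
  rw [tsum_pmf_map_mul, ← p.tsum_coe, ← ENNReal.tsum_add]
  refine tsum_congr fun r => ?_
  push_cast
  ring

theorem QueryAlg.penalizedCost_eq_tsum (v : Finset (Fin m) → ℝ) (O : DemandOracle v)
    (pen : Finset (Fin m) → ℝ≥0∞) (A : QueryAlg m) (h : List (Event m)) :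
    A.penalizedCost v O pen h = ∑' r, A.run v O h r * ((r.2 : ℝ≥0∞) + pen r.1) := by
  induction A generalizing h with
  | output S =>
    rw [QueryAlg.penalizedCost, QueryAlg.run, tsum_eq_single (S, 0)]
    · simp
    · intro b hb
      simp [PMF.pure_apply, hb]
  | valueQuery S next ih =>
    rw [QueryAlg.penalizedCost, QueryAlg.run, tsum_pmf_map_succ_mul, ih]
  | demandQuery p next ih =>
    rw [QueryAlg.penalizedCost, QueryAlg.run, tsum_pmf_map_succ_mul, ih]
  | random n next ih =>
    rw [QueryAlg.penalizedCost, QueryAlg.run, tsum_pmf_bind_mul, tsum_fintype, Finset.mul_sum]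
    refine Finset.sum_congr rfl fun i _ => ?_
    rw [ih, PMF.uniformOfFintype_apply, Fintype.card_fin]

open Classical in
/-- The penalty that is infinite on the sets that are not `k`-optimal. -/
noncomputable def optPenalty (v : Finset (Fin m) → ℝ) (k : ℕ) (S : Finset (Fin m)) : ℝ≥0∞ :=
  if IsKOptimal v k S then 0 else ⊤

theorem QueryAlg.expectedQueries_le_penalizedCost (v : Finset (Fin m) → ℝ) (O : DemandOracle v)
    (pen : Finset (Fin m) → ℝ≥0∞) (A : QueryAlg m) :
    A.expectedQueries v O ≤ A.penalizedCost v O pen [] := by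
  rw [QueryAlg.penalizedCost_eq_tsum, QueryAlg.expectedQueries]
  exact ENNReal.tsum_le_tsum fun r => mul_le_mul_right le_self_add _

/-- A wrong output of positive probability would contribute an infinite term, so one finite bound
gives both correctness and the query count. -/
theorem QueryAlg.alwaysFinds_of_penalizedCost_ne_top (v : Finset (Fin m) → ℝ)
    (O : DemandOracle v) (k : ℕ) (A : QueryAlg m)
    (hA : A.penalizedCost v O (optPenalty v k) [] ≠ ⊤) : A.AlwaysFinds v O k := by
  intro r hr
  by_contra hk
  rw [QueryAlg.penalizedCost_eq_tsum] at hA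
  refine ENNReal.ne_top_of_tsum_ne_top hA r ?_
  rw [optPenalty, if_neg hk, add_top, ENNReal.mul_top ((PMF.mem_support_iff _ _).1 hr)]

end Cost

/-! ### Random pivots and random orders -/

section Combinatorics

theorem sum_range_succ_mul_sub (n k : ℕ) :
    ∑ i ∈ range k, ((i : ℝ) + 1) * (n - i) =
      n * k * (k + 1) / 2 - (k - 1) * k * (k + 1) / 3 := by
  induction k with
  | zero => simp
  | succ k ih =>
    rw [sum_range_succ, ih]
    push_cast
    ring

/-- The larger of the numbers of elements of `X` strictly above and strictly below `j`. -/
noncomputable def largerSide {ι : Type*} (u : ι → ℝ) (X : Finset ι) (j : ι) : ℕ :=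
  max #{x ∈ X | u j < u x} #{x ∈ X | u x < u j}

theorem largerSide_lt_card {ι : Type*} (u : ι → ℝ) {X : Finset ι} {j : ι} (hj : j ∈ X) :
    largerSide u X j < #X :=
  max_lt (card_lt_card (filter_ssubset.2 ⟨j, hj, lt_irrefl _⟩))
    (card_lt_card (filter_ssubset.2 ⟨j, hj, lt_irrefl _⟩))

theorem exists_monotone_enumeration {ι : Type*} (u : ι → ℝ) {X : Finset ι} {n : ℕ}
    (hn : #X = n) : ∃ e : Fin n ≃ X, Monotone fun i => u (e i) := by
  let e₀ : Fin n ≃ X := (X.equivFinOfCardEq hn).symm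
  exact ⟨(Tuple.sort fun i => u (e₀ i)).trans e₀, Tuple.monotone_sort fun i => u (e₀ i)⟩

theorem largerSide_enumeration_le {ι : Type*} (u : ι → ℝ) {X : Finset ι} {n : ℕ}
    (e : Fin n ≃ X) (he : Monotone fun i => u (e i)) (i : Fin n) :
    largerSide u X (e i) ≤ max (n - 1 - i) i := by
  classical
  refine max_le_max ?_ ?_
  · rw [← Fin.card_Ioi]
    refine card_le_card_of_surjOn (fun i => (e i : ι)) ?_
    intro x hx
    simp only [coe_filter, Set.mem_ofPred_eq] at hx
    refine ⟨e.symm ⟨x, hx.1⟩, ?_, by simp⟩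
    rw [coe_Ioi, Set.mem_Ioi]
    by_contra hle
    have := he (not_lt.1 hle)
    simp only [Equiv.apply_symm_apply] at this
    linarith [hx.2]
  · rw [← Fin.card_Iio]
    refine card_le_card_of_surjOn (fun i => (e i : ι)) ?_
    intro x hx
    simp only [coe_filter, Set.mem_ofPred_eq] at hx
    refine ⟨e.symm ⟨x, hx.1⟩, ?_, by simp⟩
    rw [coe_Iio, Set.mem_Iio]
    by_contra hle
    have := he (not_lt.1 hle)
    simp only [Equiv.apply_symm_apply] at this
    linarith [hx.2]

/-- Linearizing log at n + 1 turns the gain of the pivot of rank i into a quadratic in i; these sum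
to n(n + 1)(n + 2)/6 over (n + 1)², which is at least n/6. -/
theorem sum_log_largerSide_le {ι : Type*} (u : ι → ℝ) (X : Finset ι) :
    ∑ j ∈ X, Real.log (largerSide u X j + 1) ≤ #X * (Real.log (#X + 1) - 1 / 6) := by
  generalize hn : #X = n
  obtain ⟨e, he⟩ := exists_monotone_enumeration u hn
  have hpos : (0 : ℝ) < n + 1 := by positivity
  have key : ∀ i : Fin n, Real.log (largerSide u X (e i) + 1) ≤
      Real.log (n + 1) - ((i : ℝ) + 1) * (n - i) / (n + 1) ^ 2 := by
    intro i
    have hM := largerSide_enumeration_le u e he i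
    have hi : (i : ℕ) + 1 ≤ n := i.2
    have hi' : ((i : ℕ) : ℝ) + 1 ≤ n := by exact_mod_cast hi
    set M := largerSide u X (e i)
    have h1 : Real.log ((M + 1) / (n + 1)) ≤ (M + 1) / (n + 1) - 1 :=
      Real.log_le_sub_one_of_pos (by positivity)
    rw [Real.log_div (by positivity) (by positivity)] at h1
    -- n - M is at least the smaller of i + 1 and n - i, and the larger is at most n + 1.
    have h2 : ((i : ℝ) + 1) * (n - i) ≤ (n - M) * (n + 1) := by
      have hi0 : (0 : ℝ) ≤ (i : ℕ) := Nat.cast_nonneg _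
      rcases le_max_iff.1 hM with h | h
      · have h3 : M + 1 + (i : ℕ) ≤ n := by omega
        have h4 : (M : ℝ) + 1 + (i : ℕ) ≤ n := by exact_mod_cast h3
        nlinarith
      · have h4 : (M : ℝ) ≤ (i : ℕ) := by exact_mod_cast h
        nlinarith
    have h5 : ((M : ℝ) + 1) / (n + 1) - 1 ≤ - (((i : ℝ) + 1) * (n - i) / (n + 1) ^ 2) := by
      have : ((M : ℝ) + 1) / (n + 1) - 1 = - (((n - M) * (n + 1)) / (n + 1) ^ 2) := by
        field_simp
        ring
      rw [this]
      gcongr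
    linarith
  have hsum : ∑ j ∈ X, Real.log (largerSide u X j + 1) =
      ∑ i : Fin n, Real.log (largerSide u X (e i) + 1) := by
    rw [← sum_coe_sort X, ← e.sum_comp]
  rw [hsum]
  refine (sum_le_sum fun i _ => key i).trans ?_
  rw [sum_sub_distrib, ← sum_div, Fin.sum_univ_eq_sum_range fun i => ((i : ℝ) + 1) * (n - i),
    sum_range_succ_mul_sub]
  simp only [sum_const, card_univ, Fintype.card_fin, nsmul_eq_mul]
  have : (n : ℝ) * (1 / 6) ≤
      ((n : ℝ) * n * (n + 1) / 2 - (n - 1) * n * (n + 1) / 3) / (n + 1) ^ 2 := by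
    rw [le_div_iff₀ (by positivity)]
    nlinarith [mul_nonneg (Nat.cast_nonneg (α := ℝ) n) hpos.le]
  linarith

/-- In a uniformly random order, each element of `X` is the first one equally often. -/
theorem card_mul_sum_perm_first {m : ℕ} (X : Finset (Fin m))
    (φ : Equiv.Perm (Fin m) → Fin m) (hφ : ∀ σ, φ σ ∈ X) (hmin : ∀ σ : Equiv.Perm (Fin m), ∀ x ∈ X, σ (φ σ) ≤ σ x)
    (g : Fin m → ℝ) :
    #X * ∑ σ, g (φ σ) = Fintype.card (Equiv.Perm (Fin m)) * ∑ j ∈ X, g j := by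
  have huniq : ∀ σ : Equiv.Perm (Fin m), ∀ j ∈ X, (∀ x ∈ X, σ j ≤ σ x) → φ σ = j :=
    fun σ j hj h => σ.injective (le_antisymm (hmin σ j hj) (h _ (hφ σ)))
  have hle : ∀ i ∈ X, ∀ j ∈ X, #{σ | φ σ = i} ≤ #{σ | φ σ = j} := by
    intro i hi j hj
    have hswap : ∀ x ∈ X, Equiv.swap i j x ∈ X := by
      intro x hx
      rw [Equiv.swap_apply_def]
      split_ifs <;> assumption
    -- Exchanging the positions of i and j injects the orders with i first into those with j first.
    refine card_le_card_of_injOn (fun σ => σ * Equiv.swap i j) ?_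
      (fun _ _ _ _ h => mul_right_cancel h)
    intro σ hσ
    simp only [coe_filter, mem_univ, true_and, Set.mem_ofPred_eq] at hσ ⊢
    refine huniq _ j hj fun x hx => ?_
    simp only [Equiv.Perm.coe_mul, Function.comp_apply, Equiv.swap_apply_right]
    rw [← hσ]
    exact hmin σ _ (by rw [hσ]; exact hswap x hx)
  obtain ⟨e, he⟩ : ∃ e : ℕ, ∀ j ∈ X, #{σ | φ σ = j} = e :=
    ⟨_, fun j hj => le_antisymm (hle j hj _ (hφ 1)) (hle _ (hφ 1) j hj)⟩
  have hfib : ∀ f : Fin m → ℝ, ∑ σ, f (φ σ) = e * ∑ j ∈ X, f j := by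
    intro f
    rw [← sum_fiberwise_of_maps_to (fun σ _ => hφ σ), mul_sum]
    refine sum_congr rfl fun j hj => ?_
    rw [sum_congr rfl fun σ hσ => by rw [(mem_filter.1 hσ).2], sum_const, he j hj, nsmul_eq_mul]
  have hcard : (Fintype.card (Equiv.Perm (Fin m)) : ℝ) = e * #X := by
    simpa [Fintype.card_perm] using hfib fun _ => 1
  rw [hcard, hfib]
  ring

end Combinatorics

/-! ### Top sets and demand at a uniform price -/

section TopSets

variable {m : ℕ}

/-- Every item of `S` is worth at least as much as every item outside of `S`. -/
def IsTop (u : Fin m → ℝ) (S : Finset (Fin m)) : Prop :=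
  ∀ i ∈ S, ∀ j ∉ S, u j ≤ u i

/-- Exchange argument: S \ T and T \ S have equal size, and any bijection between them compares
values termwise. -/
theorem IsTop.isKOptimal {v : Finset (Fin m) → ℝ} (hv : IsAdditiveValuation v)
    {S : Finset (Fin m)} (hS : IsTop (fun i => v {i}) S) : IsKOptimal v #S S := by
  refine ⟨rfl, fun T hT => ?_⟩
  rw [hv.additive T, hv.additive S, ← sum_inter_add_sum_sdiff T S, ← sum_inter_add_sum_sdiff S T,
    inter_comm T S]
  gcongr _ + ?_
  have hcard : #(T \ S) = #(S \ T) := by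
    have h1 := card_sdiff_add_card_inter T S
    have h2 := card_sdiff_add_card_inter S T
    rw [inter_comm] at h2
    omega
  let e := Finset.equivOfCardEq hcard
  rw [← sum_coe_sort (T \ S), ← sum_coe_sort (S \ T), ← e.sum_comp]
  exact sum_le_sum fun i _ => hS _ (mem_sdiff.1 (e i).2).1 _ (mem_sdiff.1 i.2).2

theorem IsDemanded.price_le {v : Finset (Fin m) → ℝ} (hv : IsAdditiveValuation v)
    {p : Fin m → ℝ≥0} {D : Finset (Fin m)} (hD : IsDemanded v p D) {i : Fin m} (hi : i ∈ D) :
    (p i : ℝ) ≤ v {i} := by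
  have h := hD (D.erase i)
  rw [hv.additive, hv.additive D, ← add_sum_erase D _ hi, ← add_sum_erase D _ hi] at h
  linarith

theorem IsDemanded.le_price {v : Finset (Fin m) → ℝ} (hv : IsAdditiveValuation v)
    {p : Fin m → ℝ≥0} {D : Finset (Fin m)} (hD : IsDemanded v p D) {i : Fin m} (hi : i ∉ D) :
    v {i} ≤ p i := by
  have h := hD (insert i D)
  rw [hv.additive, hv.additive D, sum_insert hi, sum_insert hi] at h
  linarith

/-- The sets `A ⊆ B` enclose a `k`-optimal set, and the items of `B \ A` have values between
`a` and `b`. -/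
structure Encloses (u : Fin m → ℝ) (k : ℕ) (A B : Finset (Fin m)) (a b : ℝ≥0) : Prop where
  subset : A ⊆ B
  top_left : IsTop u A
  top_right : IsTop u B
  card_left : #A ≤ k
  card_right : k ≤ #B
  lower : ∀ j ∈ B \ A, a ≤ u j
  upper : ∀ j ∈ B \ A, u j ≤ b

/-- The answer `D` to a demand query, clamped to lie between `A` and `B`. -/
def clamp (A B D : Finset (Fin m)) : Finset (Fin m) := A ∪ (D ∩ B)

section Clamp

variable {v : Finset (Fin m) → ℝ} {k : ℕ} {A B D : Finset (Fin m)} {a b p : ℝ≥0}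

theorem isTop_clamp (hv : IsAdditiveValuation v)
    (hE : Encloses (fun i => v {i}) k A B a b) (hD : IsDemanded v (fun _ => p) D) :
    IsTop (fun i => v {i}) (clamp A B D) := by
  intro i hi j hj
  simp only [clamp, mem_union, mem_inter, not_or, not_and] at hi hj
  rcases hi with hi | ⟨hi, hiB⟩
  · exact hE.top_left i hi j hj.1
  · by_cases hjB : j ∈ B
    · exact (hD.le_price hv fun h => hj.2 h hjB).trans (hD.price_le hv hi)
    · exact hE.top_right i hiB j hjB

theorem Encloses.clamp_right (hv : IsAdditiveValuation v)
    (hE : Encloses (fun i => v {i}) k A B a b) (hD : IsDemanded v (fun _ => p) D)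
    (hk : k ≤ #(clamp A B D)) : Encloses (fun i => v {i}) k A (clamp A B D) p b := by
  have hsub : ∀ j ∈ clamp A B D \ A, j ∈ D ∧ j ∈ B \ A := by
    intro j
    simp only [clamp, mem_sdiff, mem_union, mem_inter]
    tauto
  exact ⟨subset_union_left, hE.top_left, isTop_clamp hv hE hD, hE.card_left, hk,
    fun j hj => hD.price_le hv (hsub j hj).1, fun j hj => hE.upper j (hsub j hj).2⟩

theorem Encloses.clamp_left (hv : IsAdditiveValuation v)
    (hE : Encloses (fun i => v {i}) k A B a b) (hD : IsDemanded v (fun _ => p) D)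
    (hk : #(clamp A B D) ≤ k) : Encloses (fun i => v {i}) k (clamp A B D) B a p := by
  have hsub : ∀ j ∈ B \ clamp A B D, j ∉ D ∧ j ∈ B \ A := by
    intro j
    simp only [clamp, mem_sdiff, mem_union, mem_inter]
    tauto
  exact ⟨union_subset hE.subset inter_subset_right, isTop_clamp hv hE hD, hE.top_right, hk,
    hE.card_right, fun j hj => hE.lower j (hsub j hj).2, fun j hj => hD.le_price hv (hsub j hj).1⟩

theorem clamp_sdiff_subset : clamp A B D \ A ⊆ B \ A := by
  intro j
  simp only [clamp, mem_sdiff, mem_union, mem_inter]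
  tauto

theorem sdiff_clamp_subset : B \ clamp A B D ⊆ B \ A :=
  sdiff_subset_sdiff Subset.rfl subset_union_left

end Clamp

open Classical in
/-- A set of size `k` between `A` and `B`, if there is one. -/
noncomputable def between (k : ℕ) (A B : Finset (Fin m)) : Finset (Fin m) :=
  if h : ∃ S, A ⊆ S ∧ S ⊆ B ∧ #S = k then h.choose else ∅

/-- When the undecided items are all tied, any choice among them completes A to a top set. -/
theorem Encloses.isKOptimal_between {v : Finset (Fin m) → ℝ} (hv : IsAdditiveValuation v)
    {k : ℕ} {A B : Finset (Fin m)} {a b : ℝ≥0} (hE : Encloses (fun i => v {i}) k A B a b)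
    (c : ℝ) (hc : ∀ j ∈ B \ A, v {j} = c) : IsKOptimal v k (between k A B) := by
  have hex : ∃ S, A ⊆ S ∧ S ⊆ B ∧ #S = k :=
    exists_subsuperset_card_eq hE.subset hE.card_left hE.card_right
  rw [between, dif_pos hex]
  obtain ⟨hAS, hSB, hk⟩ := hex.choose_spec
  set S := hex.choose
  have htop : IsTop (fun i => v {i}) S := by
    intro i hi j hj
    by_cases hiA : i ∈ A
    · exact hE.top_left i hiA j fun h => hj (hAS h)
    by_cases hjB : j ∈ B
    · exact ((hc j (mem_sdiff.2 ⟨hjB, fun h => hj (hAS h)⟩)).trans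
        (hc i (mem_sdiff.2 ⟨hSB hi, hiA⟩)).symm).le
    · exact hE.top_right i (hSB hi) j hjB
  have := htop.isKOptimal hv
  rwa [hk] at this

end TopSets

/-! ### Quickselect with pivots that avoid ties -/

section Algorithm

variable {m : ℕ}

/-- Binary search, in `[lo, lo + 2 ^ d)`, for the first `t` such that not all items of `S t` have
value `c`. -/
noncomputable def QueryAlg.binarySearch (S : ℕ → Finset (Fin m)) (c : ℝ)
    (cont : ℕ → QueryAlg m) : ℕ → ℕ → QueryAlg m
  | 0, lo => cont lo
  | d + 1, lo => .valueQuery (S (lo + 2 ^ d - 1)) fun x =>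
      if x = c * #(S (lo + 2 ^ d - 1)) then binarySearch S c cont d (lo + 2 ^ d)
      else binarySearch S c cont d lo

/-- The permutations of the items, numbered so that one can be drawn at random. -/
noncomputable def permOfIndex (m : ℕ) :
    Fin (Fintype.card (Equiv.Perm (Fin m)) - 1 + 1) ≃ Equiv.Perm (Fin m) :=
  (finCongr (Nat.succ_pred_eq_of_pos Fintype.card_pos)).trans (Fintype.equivFin _).symm

/-- Find a uniformly random item of `B \ A` whose value is not `c`, use its value as a price
and continue with the part that is left. -/
noncomputable def QueryAlg.pivot (k : ℕ)
    (rec : Finset (Fin m) → Finset (Fin m) → ℝ≥0 → ℝ≥0 → QueryAlg m)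
    (A B : Finset (Fin m)) (a b : ℝ≥0) (c : ℝ) : QueryAlg m :=
  .valueQuery (B \ A) fun x =>
    if x = c * #(B \ A) then .output (between k A B)
    else .random (Fintype.card (Equiv.Perm (Fin m)) - 1) fun i =>
      binarySearch (fun t => {j ∈ B \ A | (permOfIndex m i j : ℕ) ≤ t}) c
        (fun t => .valueQuery {j | (permOfIndex m i j : ℕ) = t} fun w =>
          .demandQuery (fun _ => w.toNNReal) fun D =>
            if k ≤ #(clamp A B D) then rec A (clamp A B D) w.toNNReal b
            else rec (clamp A B D) B a w.toNNReal)
        (Nat.clog 2 m) 0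

/-- The search for a `k`-optimal set between `A` and `B`, where the items of `B \ A` have values
between `a` and `b`, in at most the given number of rounds. -/
noncomputable def QueryAlg.select (k : ℕ) :
    ℕ → Finset (Fin m) → Finset (Fin m) → ℝ≥0 → ℝ≥0 → QueryAlg m
  | 0, _, _, _, _ => .output ∅
  | n + 1, A, B, a, b => .demandQuery (fun _ => (a + b) / 2) fun D =>
      if k ≤ #(clamp A B D) then pivot k (select k n) A (clamp A B D) ((a + b) / 2) b b
      else pivot k (select k n) (clamp A B D) B a ((a + b) / 2) a

/-- The algorithm that finds a `k`-optimal set. -/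
noncomputable def QueryAlg.findOptimal (m k : ℕ) : QueryAlg m :=
  if m ≤ 1 then .output (if k = 0 then ∅ else univ)
  else .valueQuery univ fun b => select k (m + 1) ∅ univ 0 b.toNNReal

end Algorithm

/-! ### Expected number of queries -/

section Analysis

variable {m : ℕ} {v : Finset (Fin m) → ℝ} {O : DemandOracle v} {pen : Finset (Fin m) → ℝ≥0∞}

theorem QueryAlg.penalizedCost_binarySearch_le {S : ℕ → Finset (Fin m)} {c : ℝ}
    {cont : ℕ → QueryAlg m} {t : ℕ} (ht : ∀ s, v (S s) = c * #(S s) ↔ s < t) {K : ℝ≥0∞}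
    (hK : ∀ h, (cont t).penalizedCost v O pen h ≤ K) (d lo : ℕ) (hlo : lo ≤ t)
    (hhi : t < lo + 2 ^ d) (h : List (Event m)) :
    (binarySearch S c cont d lo).penalizedCost v O pen h ≤ K + d := by
  induction d generalizing lo h with
  | zero =>
    obtain rfl : t = lo := by simp at hhi; omega
    simpa [binarySearch] using hK h
  | succ d ih =>
    rw [binarySearch, penalizedCost, Nat.cast_succ, ← add_assoc]
    have hd : 0 < 2 ^ d := by positivity
    rw [pow_succ] at hhi
    gcongr
    split_ifs with hx <;> rw [ht] at hx
    · exact ih _ (by omega) (by omega) _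
    · exact ih _ hlo (by omega) _

/-- With all values on one side of c, deviations from c cannot cancel in the sum. -/
theorem IsAdditiveValuation.eq_mul_card_iff (hv : IsAdditiveValuation v) {S : Finset (Fin m)}
    {c : ℝ} (hc : (∀ j ∈ S, c ≤ v {j}) ∨ ∀ j ∈ S, v {j} ≤ c) :
    v S = c * #S ↔ ∀ j ∈ S, v {j} = c := by
  have hconst : c * #S = ∑ _j ∈ S, c := by rw [sum_const, nsmul_eq_mul, mul_comm]
  rw [hv.additive, hconst]
  rcases hc with hc | hc
  · rw [eq_comm, sum_eq_sum_iff_of_le hc]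
    exact forall₂_congr fun _ _ => eq_comm
  · exact sum_eq_sum_iff_of_le hc

/-- The bound on the number of queries of the search when `n` items lie strictly between the
known bounds. -/
noncomputable def queryBound (m n : ℕ) : ℝ :=
  (Nat.clog 2 m + 4) * (1 + 6 * Real.log (n + 1))

theorem queryBound_mono {n n' : ℕ} (h : n ≤ n') : queryBound m n ≤ queryBound m n' := by
  unfold queryBound
  gcongr

theorem le_queryBound (n : ℕ) : (Nat.clog 2 m + 4 : ℝ) ≤ queryBound m n := by
  have h : 0 ≤ Real.log (n + 1) := Real.log_nonneg (by simp)
  unfold queryBound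
  nlinarith [(Nat.cast_nonneg (Nat.clog 2 m) : (0 : ℝ) ≤ _)]

/-- The average drop 1/6 of the logarithm pays for clog + 4 queries: clog + 2 for the binary search,
the pivot's value and its demand query, and 2 for the midpoint query and the test for ties. -/
theorem sum_queryBound_largerSide_le (u : Fin m → ℝ) (X : Finset (Fin m)) :
    ∑ j ∈ X, (queryBound m (largerSide u X j) + (Nat.clog 2 m + 2)) ≤
      #X * (queryBound m #X - 2) := by
  have h := sum_log_largerSide_le u X
  simp only [queryBound, sum_add_distrib, ← mul_sum, sum_const, nsmul_eq_mul, mul_one]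
  have hd : (0 : ℝ) ≤ Nat.clog 2 m + 4 := by positivity
  nlinarith [mul_le_mul_of_nonneg_left h hd]

/-- `rec` solves every enclosed instance with fewer than `n` items strictly between the bounds
within the query bound. -/
def SolvesBelow (O : DemandOracle v) (k n : ℕ)
    (rec : Finset (Fin m) → Finset (Fin m) → ℝ≥0 → ℝ≥0 → QueryAlg m) : Prop :=
  ∀ A B a b, Encloses (fun i => v {i}) k A B a b →
    #{j ∈ B \ A | (a : ℝ) < v {j} ∧ v {j} < b} < n → ∀ h,
      (rec A B a b).penalizedCost v O (optPenalty v k) h ≤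
        ENNReal.ofReal (queryBound m #{j ∈ B \ A | (a : ℝ) < v {j} ∧ v {j} < b})

section Pivot

variable {k n : ℕ} {rec : Finset (Fin m) → Finset (Fin m) → ℝ≥0 → ℝ≥0 → QueryAlg m}
  {A B : Finset (Fin m)} {a b : ℝ≥0} {c : ℝ}

/-- Ties with the pivot become endpoint values and leave the count, so what remains lies strictly on
one side of the pivot, wherever the oracle puts the ties. -/
theorem SolvesBelow.split_le (hv : IsAdditiveValuation v) (hrec : SolvesBelow O k n rec)
    (hE : Encloses (fun i => v {i}) k A B a b) (hc : c = a ∨ c = b)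
    (hn : #{j ∈ B \ A | v {j} ≠ c} ≤ n) {j : Fin m} (hj : j ∈ B \ A) (hjc : v {j} ≠ c)
    {D : Finset (Fin m)} (hD : IsDemanded v (fun _ => (v {j}).toNNReal) D) (h : List (Event m)) :
    (if k ≤ #(clamp A B D) then rec A (clamp A B D) (v {j}).toNNReal b
      else rec (clamp A B D) B a (v {j}).toNNReal).penalizedCost v O (optPenalty v k) h ≤
      ENNReal.ofReal
        (queryBound m (largerSide (fun i => v {i}) {j ∈ B \ A | v {j} ≠ c} j)) := by
  have hw : ((v {j}).toNNReal : ℝ) = v {j} := Real.coe_toNNReal _ (hv.nonneg _)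
  have hlt := (largerSide_lt_card (fun i => v {i}) (mem_filter.2 ⟨hj, hjc⟩)).trans_le hn
  have hja := hE.lower j hj
  have hjb := hE.upper j hj
  split_ifs with hk
  · have hle : #{x ∈ clamp A B D \ A | ((v {j}).toNNReal : ℝ) < v {x} ∧ v {x} < b} ≤
        largerSide (fun i => v {i}) {j ∈ B \ A | v {j} ≠ c} j := by
      refine le_max_of_le_left (card_le_card fun x hx => ?_)
      rw [mem_filter, hw] at hx
      refine mem_filter.2 ⟨mem_filter.2 ⟨clamp_sdiff_subset hx.1, ?_⟩, hx.2.1⟩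
      rintro rfl
      rcases hc with hc | hc <;> linarith [hx.2.1, hx.2.2]
    exact (hrec _ _ _ _ (hE.clamp_right hv hD hk) (hle.trans_lt hlt) h).trans
      (ENNReal.ofReal_le_ofReal (queryBound_mono hle))
  · have hle : #{x ∈ B \ clamp A B D | (a : ℝ) < v {x} ∧ v {x} < ((v {j}).toNNReal : ℝ)} ≤
        largerSide (fun i => v {i}) {j ∈ B \ A | v {j} ≠ c} j := by
      refine le_max_of_le_right (card_le_card fun x hx => ?_)
      rw [mem_filter, hw] at hx
      refine mem_filter.2 ⟨mem_filter.2 ⟨sdiff_clamp_subset hx.1, ?_⟩, hx.2.2⟩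
      rintro rfl
      rcases hc with hc | hc <;> linarith [hx.2.1, hx.2.2]
    exact (hrec _ _ _ _ (hE.clamp_left hv hD (not_le.1 hk).le) (hle.trans_lt hlt) h).trans
      (ENNReal.ofReal_le_ofReal (queryBound_mono hle))

theorem SolvesBelow.pivot_le (hv : IsAdditiveValuation v) (hrec : SolvesBelow O k n rec)
    (hE : Encloses (fun i => v {i}) k A B a b) (hc : c = a ∨ c = b)
    (hn : #{j ∈ B \ A | v {j} ≠ c} ≤ n) (h : List (Event m)) :
    (QueryAlg.pivot k rec A B a b c).penalizedCost v O (optPenalty v k) h ≤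
      ENNReal.ofReal (queryBound m #{j ∈ B \ A | v {j} ≠ c} - 1) := by
  set X : Finset (Fin m) := {j ∈ B \ A | v {j} ≠ c} with hX
  have hside : ∀ S ⊆ B \ A, (v S = c * #S ↔ ∀ j ∈ S, v {j} = c) := by
    intro S hS
    apply hv.eq_mul_card_iff
    rcases hc with rfl | rfl
    · exact .inl fun j hj => hE.lower j (hS hj)
    · exact .inr fun j hj => hE.upper j (hS hj)
  have hbase := le_queryBound (m := m) #X
  have hd0 : (0 : ℝ) ≤ Nat.clog 2 m := Nat.cast_nonneg _
  rw [QueryAlg.pivot, QueryAlg.penalizedCost]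
  split_ifs with hx
  · rw [hside _ Subset.rfl] at hx
    rw [QueryAlg.penalizedCost, optPenalty, if_pos (hE.isKOptimal_between hv c hx), zero_add,
      ← ENNReal.ofReal_one]
    exact ENNReal.ofReal_le_ofReal (by linarith)
  · rw [hside _ Subset.rfl] at hx
    push Not at hx
    obtain ⟨j₀, hj₀, hj₀c⟩ := hx
    have hne : X.Nonempty := ⟨j₀, mem_filter.2 ⟨hj₀, hj₀c⟩⟩
    -- `φ σ` is the untied item that comes first in the order `σ`; a prefix is all ties exactly when
    -- it ends before that item.
    choose φ hφ hmin using fun σ : Equiv.Perm (Fin m) => exists_min_image X σ hne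
    let g : Fin m → ℝ := fun j =>
      queryBound m (largerSide (fun i => v {i}) X j) + (Nat.clog 2 m + 2)
    have hg : ∀ j, 0 ≤ g j := fun j => by
      have := le_queryBound (m := m) (largerSide (fun i => v {i}) X j)
      simp only [g]
      linarith
    rw [QueryAlg.penalizedCost]
    have hbranch : ∀ i : Fin (Fintype.card (Equiv.Perm (Fin m)) - 1 + 1), ∀ h : List (Event m),
        (QueryAlg.binarySearch (fun t => {j ∈ B \ A | (permOfIndex m i j : ℕ) ≤ t}) c
          (fun t => .valueQuery {j | (permOfIndex m i j : ℕ) = t} fun w =>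
            .demandQuery (fun _ => w.toNNReal) fun D =>
              if k ≤ #(clamp A B D) then rec A (clamp A B D) w.toNNReal b
              else rec (clamp A B D) B a w.toNNReal)
          (Nat.clog 2 m) 0).penalizedCost v O (optPenalty v k) h ≤
        ENNReal.ofReal (g (φ (permOfIndex m i))) := by
      intro i h
      set σ := permOfIndex m i
      have hφσ := mem_filter.1 (hφ σ)
      have hgσ : ENNReal.ofReal (g (φ σ)) =
          ENNReal.ofReal (queryBound m (largerSide (fun i => v {i}) X (φ σ))) + 1 + 1
            + (Nat.clog 2 m : ℕ) := by
        have := le_queryBound (m := m) (largerSide (fun i => v {i}) X (φ σ))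
        rw [← ENNReal.ofReal_one, ← ENNReal.ofReal_natCast, ← ENNReal.ofReal_add,
          ← ENNReal.ofReal_add, ← ENNReal.ofReal_add]
        · congr 1
          simp only [g]
          ring
        all_goals linarith
      rw [hgσ]
      refine QueryAlg.penalizedCost_binarySearch_le (t := σ (φ σ)) ?_ ?_ _ _ (Nat.zero_le _) ?_ h
      · intro s
        rw [hside _ (filter_subset _ _)]
        constructor
        · intro hs
          by_contra hlt
          exact hφσ.2 (hs _ (mem_filter.2 ⟨hφσ.1, not_lt.1 hlt⟩))
        · intro hs j hj
          by_contra hjc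
          have := hmin σ j (mem_filter.2 ⟨(mem_filter.1 hj).1, hjc⟩)
          have := (mem_filter.1 hj).2
          omega
      · intro h
        have hsing : ({j | (σ j : ℕ) = σ (φ σ)} : Finset (Fin m)) = {φ σ} := by
          ext j
          simp [Fin.val_inj]
        rw [hsing, QueryAlg.penalizedCost, QueryAlg.penalizedCost]
        gcongr
        exact hrec.split_le hv hE hc hn hφσ.1 hφσ.2 (O.demanded _ _) _
      · rw [zero_add]
        exact (σ (φ σ)).2.trans_le (Nat.le_pow_clog one_lt_two _)
    have hX0 : (0 : ℝ) < #X := by exact_mod_cast hne.card_pos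
    have hN : (0 : ℝ) < Fintype.card (Equiv.Perm (Fin m)) := by exact_mod_cast Fintype.card_pos
    have hsum : ∑ σ, g (φ σ) ≤
        Fintype.card (Equiv.Perm (Fin m)) * (queryBound m #X - 2) := by
      have h1 := card_mul_sum_perm_first X φ hφ hmin g
      have h2 := sum_queryBound_largerSide_le (fun i => v {i}) X
      have h3 : ∑ σ, g (φ σ) = Fintype.card (Equiv.Perm (Fin m)) * (∑ j ∈ X, g j) / #X := by
        rw [eq_div_iff hX0.ne', ← h1, mul_comm]
      rw [h3, div_le_iff₀ hX0, mul_assoc]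
      exact mul_le_mul_of_nonneg_left (h2.trans_eq (mul_comm _ _)) hN.le
    have hone : ENNReal.ofReal (queryBound m #X - 1) =
        ENNReal.ofReal (queryBound m #X - 2) + 1 := by
      rw [← ENNReal.ofReal_one, ← ENNReal.ofReal_add]
      · congr 1
        ring
      all_goals linarith
    have hidx : ((Fintype.card (Equiv.Perm (Fin m)) - 1 + 1 : ℕ) : ℝ≥0∞) =
        (Fintype.card (Equiv.Perm (Fin m)) : ℕ) := by
      rw [Nat.sub_add_cancel Fintype.card_pos]
    rw [hone]
    gcongr
    rw [ENNReal.inv_mul_le_iff (by simp) (ENNReal.natCast_ne_top _), hidx,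
      ← ENNReal.ofReal_natCast, ← ENNReal.ofReal_mul hN.le]
    refine (sum_le_sum fun i _ => hbranch i _).trans ?_
    rw [(permOfIndex m).sum_comp fun σ => ENNReal.ofReal (g (φ σ)),
      ← ENNReal.ofReal_sum_of_nonneg fun σ _ => hg _]
    exact ENNReal.ofReal_le_ofReal hsum

end Pivot

/-- The number of rounds can serve as induction variable because each pivot leaves the count itself,
so the count drops every round. -/
theorem QueryAlg.solvesBelow_select (hv : IsAdditiveValuation v) (O : DemandOracle v) (k n : ℕ) :
    SolvesBelow O k n (select k n) := by
  induction n with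
  -- The dummy output at exhausted rounds is never reached: no count is below 0.
  | zero => exact fun A B a b _ hn => absurd hn (Nat.not_lt_zero _)
  | succ n ih =>
    intro A B a b hE hn h
    have hbase := le_queryBound (m := m) #{j ∈ B \ A | (a : ℝ) < v {j} ∧ v {j} < b}
    have hd0 : (0 : ℝ) ≤ Nat.clog 2 m := Nat.cast_nonneg _
    have hone : ENNReal.ofReal (queryBound m #{j ∈ B \ A | (a : ℝ) < v {j} ∧ v {j} < b}) =
        ENNReal.ofReal (queryBound m #{j ∈ B \ A | (a : ℝ) < v {j} ∧ v {j} < b} - 1) + 1 := by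
      rw [← ENNReal.ofReal_one, ← ENNReal.ofReal_add]
      · congr 1
        ring
      all_goals linarith
    rw [select, penalizedCost, hone]
    gcongr
    have hD := O.demanded h fun _ => (a + b) / 2
    set D := O.answer h fun _ => (a + b) / 2
    split_ifs with hk
    · have hE' := hE.clamp_right hv hD hk
      have hle : #{j ∈ clamp A B D \ A | v {j} ≠ b} ≤
          #{j ∈ B \ A | (a : ℝ) < v {j} ∧ v {j} < b} := by
        refine card_le_card fun j hj => ?_
        rw [mem_filter] at hj ⊢
        have h1 := hE'.lower j hj.1
        have h2 := lt_of_le_of_ne (hE'.upper j hj.1) hj.2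
        push_cast at h1
        -- A survivor below b forces a < b, so the midpoint, and with it the survivor, exceeds a.
        exact ⟨clamp_sdiff_subset hj.1, by linarith, h2⟩
      exact (ih.pivot_le hv hE' (.inr rfl) (hle.trans (Nat.lt_succ_iff.1 hn)) _).trans
        (ENNReal.ofReal_le_ofReal (sub_le_sub_right (queryBound_mono hle) _))
    · have hE' := hE.clamp_left hv hD (not_le.1 hk).le
      have hle : #{j ∈ B \ clamp A B D | v {j} ≠ a} ≤
          #{j ∈ B \ A | (a : ℝ) < v {j} ∧ v {j} < b} := by
        refine card_le_card fun j hj => ?_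
        rw [mem_filter] at hj ⊢
        have h1 := hE'.upper j hj.1
        have h2 := lt_of_le_of_ne (hE'.lower j hj.1) hj.2.symm
        push_cast at h1
        exact ⟨sdiff_clamp_subset hj.1, h2, by linarith⟩
      exact (ih.pivot_le hv hE' (.inl rfl) (hle.trans (Nat.lt_succ_iff.1 hn)) _).trans
        (ENNReal.ofReal_le_ofReal (sub_le_sub_right (queryBound_mono hle) _))

theorem queryBound_add_one_le (hm : 2 ≤ m) :
    queryBound m m + 1 ≤ 200 * Real.log m ^ 3 := by
  have hm' : (2 : ℝ) ≤ m := by exact_mod_cast hm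
  set l := Real.log m with hl
  have hl2 : Real.log 2 ≤ l := Real.log_le_log two_pos hm'
  have hl0 : 0.69 < l := by linarith [Real.log_two_gt_d9]
  have hclog : (Nat.clog 2 m : ℝ) ≤ 3 * l := by
    have h1 : 2 ^ (Nat.clog 2 m).pred < m := Nat.pow_pred_clog_lt_self one_lt_two hm
    have h2 : (2 : ℝ) ^ (Nat.clog 2 m).pred ≤ m := by exact_mod_cast h1.le
    have h3 := Real.log_le_log (by positivity) h2
    rw [Real.log_pow] at h3
    have h4 : 0 < Nat.clog 2 m := Nat.clog_pos one_lt_two hm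
    have h5 : (((Nat.clog 2 m).pred : ℕ) : ℝ) + 1 = Nat.clog 2 m := by
      exact_mod_cast Nat.succ_pred_eq_of_pos h4
    have h6 : (0 : ℝ) ≤ ((Nat.clog 2 m).pred : ℕ) := Nat.cast_nonneg _
    nlinarith [Real.log_two_gt_d9]
  have hlog : Real.log (m + 1) ≤ 2 * l := by
    rw [hl, ← Nat.cast_two, ← Real.log_pow]
    exact Real.log_le_log (by positivity) (by nlinarith)
  have h1 : (Nat.clog 2 m : ℝ) + 4 ≤ 9 * l := by linarith
  have h2 : 1 + 6 * Real.log (m + 1) ≤ 13.5 * l := by linarith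
  have h3 : 0 ≤ Real.log ((m : ℝ) + 1) := Real.log_nonneg (by linarith)
  have h4 : queryBound m m ≤ 9 * l * (13.5 * l) := by
    unfold queryBound
    gcongr
  -- As l > 0.69, 121.5 l² + 1 ≤ 138 l² ≤ 200 l³.
  have h5 : 0.69 * l ^ 2 ≤ l ^ 3 := by nlinarith [sq_nonneg l]
  nlinarith

theorem QueryAlg.penalizedCost_findOptimal_le (hv : IsAdditiveValuation v) (O : DemandOracle v)
    {k : ℕ} (hk : k ≤ m) :
    (findOptimal m k).penalizedCost v O (optPenalty v k) [] ≤
      ENNReal.ofReal (200 * Real.log m ^ 3) := by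
  rw [findOptimal]
  -- For m ≤ 1 the bound is 0, so no query may be asked.
  split_ifs with hm hk0
  · subst hk0
    have h : IsKOptimal v 0 ∅ := IsTop.isKOptimal hv (S := ∅) (by simp [IsTop])
    rw [penalizedCost, optPenalty, if_pos h]
    exact zero_le
  · have hkm : k = #(univ : Finset (Fin m)) := by
      rw [card_univ, Fintype.card_fin]
      omega
    have h : IsKOptimal v k univ := hkm ▸ IsTop.isKOptimal hv (by simp [IsTop])
    rw [penalizedCost, optPenalty, if_pos h]
    exact zero_le
  · have hE : Encloses (fun i => v {i}) k ∅ univ 0 (v univ).toNNReal :=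
      ⟨subset_univ _, by simp [IsTop], by simp [IsTop], by simp, by simpa using hk,
        fun j _ => by simpa using hv.nonneg {j},
        fun j _ => by
          rw [Real.coe_toNNReal _ (hv.nonneg _)]
          exact hv.monotone _ _ (subset_univ _)⟩
    have hcard : #{j ∈ (univ : Finset (Fin m)) \ ∅ |
        ((0 : ℝ≥0) : ℝ) < v {j} ∧ v {j} < (v univ).toNNReal} ≤ m :=
      (card_le_univ _).trans_eq (Fintype.card_fin m)
    have hbase := le_queryBound (m := m) m
    have hd0 : (0 : ℝ) ≤ Nat.clog 2 m := Nat.cast_nonneg _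
    rw [penalizedCost]
    calc _ ≤ ENNReal.ofReal (queryBound m m) + 1 := by
          gcongr
          exact (solvesBelow_select hv O k (m + 1) _ _ _ _ hE (Nat.lt_succ_of_le hcard) _).trans
            (ENNReal.ofReal_le_ofReal (queryBound_mono hcard))
      _ = ENNReal.ofReal (queryBound m m + 1) := by
          rw [ENNReal.ofReal_add (by linarith) zero_le_one, ENNReal.ofReal_one]
      _ ≤ _ := ENNReal.ofReal_le_ofReal (queryBound_add_one_le (by omega))

end Analysis

end KOpt

theorem mainTheorem1 :
    ∃ (A : (m : ℕ) → (k : ℕ) → KOpt.QueryAlg m) (C : ℝ),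
      ∀ (m k : ℕ), 1 ≤ m → k ≤ m →
        ∀ (v : Finset (Fin m) → ℝ), KOpt.IsAdditiveValuation v →
          ∀ O : KOpt.DemandOracle v,
            (A m k).AlwaysFinds v O k ∧
              (A m k).expectedQueries v O ≤ ENNReal.ofReal (C * Real.log m ^ 3) := by
  refine ⟨KOpt.QueryAlg.findOptimal, 200, fun m k _ hk v hv O => ?_⟩
  have h := KOpt.QueryAlg.penalizedCost_findOptimal_le hv O hk
  exact ⟨KOpt.QueryAlg.alwaysFinds_of_penalizedCost_ne_top v O k _
      (ne_top_of_le_ne_top ENNReal.ofReal_ne_top h),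
    (KOpt.QueryAlg.expectedQueries_le_penalizedCost v O _ _).trans h⟩
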